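/- Let $\mathbb{F}$ be a field. An ACI-matrix over $\mathbb{F}$ is a matrix whose entries are polynomials over $\mathbb{F}$ of degree at most one in some indeterminates, such that no indeterminate appears in two different columns. A completion of it is the constant matrix obtained by assigning values in $\mathbb{F}$ to all indeterminates, and it has constant rank $\rho$ if all its completions have rank $\rho$. An $m\times n$ ACI-matrix is full rank if it has constant rank $\min\{m,n\}$. It is minimal full rank if it is full rank, $m<n$, and no matrix obtained from it by deleting one column is full rank; it is maximal full rank if it is full rank, $n<m$, and for no $v\in\mathbb{F}^m$ is the matrix obtained from it by adjoining the constant column $v$ full rank. Two $m\times n$ ACI-matrices $A$ and $B$ are equivalent, $A\sim B$, if $TAQ=B$ for some nonsingular constant matrix $T$ of order $m$ and some permutation matrix $Q$ of order $n$. An ACI-matrix of constant rank $\rho$ is irreducible if no matrix obtained from it by deleting one row or one column has constant rank $\rho$, and it is completely irreducible if every ACI-matrix equivalent to it is irreducible. Theorem. Let $A$ be an $m\times n$ ACI-matrix over a field $\mathbb{F}$ and let $\rho$ be an integer with $1\le\rho<\min\{m,n\}$. Then $A$ is completely irreducible of constant rank $\rho$ if and only if there are positive integers $\rho_1,\rho_2$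 with $\rho_1+\rho_2=\rho$ such that $$A\sim\begin{bmatrix}A_{11}&*\\0&A_{22}\end{bmatrix},$$ where $A_{11}$ is minimal full rank of constant rank $\rho_1$ and $A_{22}$ is maximal full rank of constant rank $\rho_2$. -/

import Mathlib

/-!
Columns of an ACI-matrix can be completed independently of each other. Hence Rado's theorem on
independent transversals, in its defect form, computes the maximal rank of a completion of `A`: it
is the minimum over the sets `J` of columns of `dim U_J + |Jᶜ|`, where `U_J` is spanned by all the
completions of the columns in `J`. If `A` has constant rank `ρ < min {m, n}`, take `J` attaining
the minimum and a nonsingular constant matrix that maps `U_J` onto the first `dim U_J` coordinates.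
The block below the columns in `J` then vanishes at all completions, so it is zero, its entries
being of degree at most one; and the rank can only be `dim U_J + |Jᶜ|` at all completions if both
diagonal blocks are full rank.

A column of `A` cannot be deleted when it lies outside the span of the other columns in some
completion, and the `i`-th row cannot be deleted when the `i`-th unit vector lies in the column
space of some completion. Every nonzero vector is mapped to a unit vector by some nonsingular
matrix, so complete irreducibility says that each column is essential in this sense and that the
column spaces of the completions cover the whole space. In a block triangular matrix with full rank
diagonal blocks, the first condition concerns `A₁₁` only, where it is minimality, and the second
one concerns `A₂₂` only, where it is maximality.
-/

namespace ACI

open MvPolynomial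

/-- A matrix over `F[x_k : k ∈ σ]` is an ACI-matrix if its entries have degree at most one and no
indeterminate appears in two different columns. -/
structure IsACI {F : Type*} [Field F] {σ μ ν : Type*}
    (A : Matrix μ ν (MvPolynomial σ F)) : Prop where
  degree_le_one : ∀ i j, (A i j).totalDegree ≤ 1
  independent : ∀ j j', j ≠ j' → ∀ i i', ∀ x ∈ (A i j).vars, x ∉ (A i' j').vars

/-- The completion of `A` given by an assignment of values in `F` to the indeterminates. -/
noncomputable def completion {F : Type*} [Field F] {σ μ ν : Type*}
    (A : Matrix μ ν (MvPolynomial σ F)) (x : σ → F) : Matrix μ ν F :=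
  A.map (eval x)

/-- The rank of `A`: the set of the ranks of all completions of `A`. -/
noncomputable def rankSet {F : Type*} [Field F] {σ μ ν : Type*} [Fintype ν]
    (A : Matrix μ ν (MvPolynomial σ F)) : Set ℕ :=
  Set.range fun x : σ → F => (completion A x).rank

/-- `A` has constant rank `ρ`. -/
def HasConstantRank {F : Type*} [Field F] {σ μ ν : Type*} [Fintype ν]
    (A : Matrix μ ν (MvPolynomial σ F)) (ρ : ℕ) : Prop :=
  rankSet A = {ρ}

/-- `A` has constant rank `min {m, n}`, where `m × n` is its size. -/
def IsFullRank {F : Type*} [Field F] {σ μ ν : Type*} [Fintype μ] [Fintype ν]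
    (A : Matrix μ ν (MvPolynomial σ F)) : Prop :=
  HasConstantRank A (min (Fintype.card μ) (Fintype.card ν))

/-- Deletion of the row `i`. -/
def deleteRow {R μ ν : Type*} (A : Matrix μ ν R) (i : μ) : Matrix {k : μ // k ≠ i} ν R :=
  A.submatrix Subtype.val id

/-- Deletion of the column `j`. -/
def deleteCol {R μ ν : Type*} (A : Matrix μ ν R) (j : ν) : Matrix μ {k : ν // k ≠ j} R :=
  A.submatrix id Subtype.val

/-- The augmented matrix `[A v]` with a constant last column `v`. -/
noncomputable def augment {F : Type*} [Field F] {σ μ ν : Type*}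
    (A : Matrix μ ν (MvPolynomial σ F)) (v : μ → F) :
    Matrix μ (ν ⊕ Unit) (MvPolynomial σ F) :=
  Matrix.fromCols A (Matrix.replicateCol Unit fun i => C (v i))

/-- `A` is full rank with fewer rows than columns, and no matrix obtained by deleting one column
is full rank. -/
def IsMinimalFullRank {F : Type*} [Field F] {σ μ ν : Type*} [Fintype μ] [Fintype ν]
    [DecidableEq ν] (A : Matrix μ ν (MvPolynomial σ F)) : Prop :=
  IsFullRank A ∧ Fintype.card μ < Fintype.card ν ∧ ∀ j : ν, ¬ IsFullRank (deleteCol A j)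

/-- `A` is full rank with fewer columns than rows, and no matrix obtained by adjoining one constant
column is full rank. -/
def IsMaximalFullRank {F : Type*} [Field F] {σ μ ν : Type*} [Fintype μ] [Fintype ν]
    (A : Matrix μ ν (MvPolynomial σ F)) : Prop :=
  IsFullRank A ∧ Fintype.card ν < Fintype.card μ ∧ ∀ v : μ → F, ¬ IsFullRank (augment A v)

/-- Equivalence of ACI-matrices of the same size: `T A Q = B` for some nonsingular constant matrix
`T` and some permutation matrix `Q`. -/
def Equivalent {F : Type*} [Field F] {σ μ ν : Type*} [Fintype μ] [DecidableEq μ] [Fintype ν]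
    [DecidableEq ν] (A B : Matrix μ ν (MvPolynomial σ F)) : Prop :=
  IsACI A ∧ IsACI B ∧ ∃ (T : Matrix μ μ F) (Q : Equiv.Perm ν), T.det ≠ 0 ∧
    T.map (C : F →+* MvPolynomial σ F) * A * Q.permMatrix (MvPolynomial σ F) = B

/-- `A` has some constant rank, which is kept after the deletion of some row. -/
def IsRowReducible {F : Type*} [Field F] {σ μ ν : Type*} [Fintype ν]
    (A : Matrix μ ν (MvPolynomial σ F)) : Prop :=
  ∃ ρ, HasConstantRank A ρ ∧ ∃ i, HasConstantRank (deleteRow A i) ρ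

/-- `A` has some constant rank, which is kept after the deletion of some column. -/
def IsColReducible {F : Type*} [Field F] {σ μ ν : Type*} [Fintype ν] [DecidableEq ν]
    (A : Matrix μ ν (MvPolynomial σ F)) : Prop :=
  ∃ ρ, HasConstantRank A ρ ∧ ∃ j, HasConstantRank (deleteCol A j) ρ

/-- `A` has some constant rank and is neither row reducible nor column reducible. -/
def IsIrreducible {F : Type*} [Field F] {σ μ ν : Type*} [Fintype ν] [DecidableEq ν]
    (A : Matrix μ ν (MvPolynomial σ F)) : Prop :=
  (∃ ρ, HasConstantRank A ρ) ∧ ¬ IsRowReducible A ∧ ¬ IsColReducible A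

/-- `A` has some constant rank and each ACI-matrix equivalent to `A` is irreducible. -/
def IsCompletelyIrreducible {F : Type*} [Field F] {σ μ ν : Type*} [Fintype μ] [DecidableEq μ]
    [Fintype ν] [DecidableEq ν] (A : Matrix μ ν (MvPolynomial σ F)) : Prop :=
  (∃ ρ, HasConstantRank A ρ) ∧ ∀ B, Equivalent A B → IsIrreducible B

/-- The `m × n` block upper triangular matrix with diagonal blocks `A₁₁`, of size `p × q`, and
`A₂₂`, of size `r × s`, upper right block `A₁₂` and lower left block zero. -/
def blockUpper {R : Type*} [Zero R] {m n p q r s : ℕ} (hm : p + r = m) (hn : q + s = n)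
    (A₁₁ : Matrix (Fin p) (Fin q) R) (A₁₂ : Matrix (Fin p) (Fin s) R)
    (A₂₂ : Matrix (Fin r) (Fin s) R) : Matrix (Fin m) (Fin n) R :=
  Matrix.reindex (finSumFinEquiv.trans (finCongr hm)) (finSumFinEquiv.trans (finCongr hn))
    (Matrix.fromBlocks A₁₁ A₁₂ 0 A₂₂)

end ACI

namespace ACI

open MvPolynomial Module
open scoped Matrix

theorem exists_greatest_minimizer_of_submodular {α M : Type*} [DecidableEq α] [AddCommMonoid M]
    [LinearOrder M] [IsOrderedCancelAddMonoid M] {g : Finset α → M}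
    (hg : ∀ J J', g (J ∪ J') + g (J ∩ J') ≤ g J + g J') (s : Finset α) :
    ∃ T ⊆ s, (∀ J ⊆ s, g T ≤ g J) ∧ ∀ J ⊆ s, g J ≤ g T → J ⊆ T := by
  obtain ⟨T₀, hT₀, hmin⟩ := s.powerset.exists_min_image g s.powerset_nonempty
  simp only [Finset.mem_powerset] at hT₀ hmin
  let minimizers := {J ∈ s.powerset | g J ≤ g T₀}
  have mem_minimizers {J : Finset α} : J ∈ minimizers ↔ J ⊆ s ∧ g J ≤ g T₀ := by simp [minimizers]
  have union_mem (J) (hJ : J ∈ minimizers) (J') (hJ' : J' ∈ minimizers) : J ∪ J' ∈ minimizers := by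
    rw [mem_minimizers] at *
    refine ⟨Finset.union_subset hJ.1 hJ'.1, le_of_add_le_add_right (a := g T₀) ?_⟩
    calc g (J ∪ J') + g T₀ ≤ g (J ∪ J') + g (J ∩ J') := by
          gcongr; exact hmin _ (Finset.inter_subset_left.trans hJ.1)
      _ ≤ g J + g J' := hg J J'
      _ ≤ g T₀ + g T₀ := add_le_add hJ.2 hJ'.2
  obtain ⟨hTs, hT⟩ := mem_minimizers.1 (Finset.sup'_mem (minimizers : Set (Finset α)) union_mem
    minimizers ⟨T₀, mem_minimizers.2 ⟨hT₀, le_rfl⟩⟩ id fun J hJ => hJ)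
  exact ⟨_, hTs, fun J hJ => hT.trans (hmin J hJ), fun J hJs hJ =>
    Finset.le_sup' id (mem_minimizers.2 ⟨hJs, hJ.trans hT⟩)⟩

section Transversal

variable {K V ν : Type*} [DivisionRing K] [AddCommGroup V] [Module K V] [FiniteDimensional K V]
  [DecidableEq ν]

theorem finrank_sup_union_add_finrank_sup_inter_le (W : Submodule K V) (U : ν → Submodule K V)
    (J J' : Finset ν) :
    finrank K ↥(W ⊔ (J ∪ J').sup U) + finrank K ↥(W ⊔ (J ∩ J').sup U) ≤
      finrank K ↥(W ⊔ J.sup U) + finrank K ↥(W ⊔ J'.sup U) := by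
  rw [← Submodule.finrank_sup_add_finrank_inf_eq (W ⊔ J.sup U), ← sup_sup_distrib_left,
    ← Finset.sup_union]
  exact Nat.add_le_add_left (Submodule.finrank_mono (le_inf
    (sup_le_sup_left (Finset.sup_mono Finset.inter_subset_left) W)
    (sup_le_sup_left (Finset.sup_mono Finset.inter_subset_right) W))) _

theorem mem_of_finrank_sup_span_singleton_le {S : Submodule K V} {w : V}
    (h : finrank K ↥(S ⊔ Submodule.span K {w}) ≤ finrank K S) : w ∈ S := by
  rw [Submodule.eq_of_le_of_finrank_le le_sup_left h]
  exact Submodule.mem_sup_right (Submodule.mem_span_singleton_self w)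

/-- If no `w ∈ X` worked, each would fail at some `J` whose join with `W` contains it; the greatest
minimizer of the quantity in `h` contains all these `J`, so it would violate `h'`. -/
theorem exists_mem_forall_le_finrank_sup_span_singleton {X : Set V} (hX : X.Nonempty) {N : ℕ}
    {s : Finset ν} {W : Submodule K V} {U : ν → Submodule K V}
    (h : ∀ J ⊆ s, N ≤ finrank K ↥(W ⊔ J.sup U) + (s \ J).card + 1)
    (h' : ∀ J ⊆ s, N ≤ finrank K ↥(W ⊔ Submodule.span K X ⊔ J.sup U) + (s \ J).card) :
    ∃ w ∈ X, ∀ J ⊆ s, N ≤ finrank K ↥(W ⊔ Submodule.span K {w} ⊔ J.sup U) + (s \ J).card := by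
  by_contra! hfail
  have exists_tight (w) (hw : w ∈ X) :
      ∃ J ⊆ s, finrank K ↥(W ⊔ J.sup U) + (s \ J).card < N ∧ w ∈ W ⊔ J.sup U := by
    obtain ⟨J, hJ, hlt⟩ := hfail w hw
    rw [sup_right_comm] at hlt
    have hle := h J hJ
    have hmono := Submodule.finrank_mono (le_sup_left (a := W ⊔ J.sup U) (b := .span K {w}))
    exact ⟨J, hJ, by omega, mem_of_finrank_sup_span_singleton_le (by omega)⟩
  obtain ⟨T, hT, hmin, hmax⟩ := exists_greatest_minimizer_of_submodular
    (g := fun J => finrank K ↥(W ⊔ J.sup U) + (s \ J).card) (fun J J' => by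
      have hfinrank := finrank_sup_union_add_finrank_sup_inter_le W U J J'
      have hcard := Finset.card_union_add_card_inter (s \ J) (s \ J')
      rw [← Finset.sdiff_inter_distrib_right, ← Finset.sdiff_union_distrib] at hcard
      omega) s
  have span_le : Submodule.span K X ≤ W ⊔ T.sup U := by
    refine Submodule.span_le.2 fun w hw => ?_
    obtain ⟨J, hJ, hlt, hwJ⟩ := exists_tight w hw
    have hJT : J ⊆ T := hmax J hJ (by have := h T hT; omega)
    exact sup_le_sup_left (Finset.sup_mono hJT) W hwJ
  obtain ⟨w, hw⟩ := hX
  obtain ⟨J, hJ, hlt, -⟩ := exists_tight w hw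
  have hN := h' T hT
  rw [sup_right_comm, sup_eq_left.2 span_le] at hN
  exact (hN.trans (hmin J hJ)).not_gt hlt

/-- The defect form of Rado's theorem on independent transversals, modulo a subspace `W` so that
the induction goes through. -/
theorem exists_transversal_le_finrank {X : ν → Set V} (hX : ∀ j, (X j).Nonempty) {N : ℕ}
    {s : Finset ν} {W : Submodule K V}
    (h : ∀ J ⊆ s, N ≤ finrank K ↥(W ⊔ J.sup fun j => Submodule.span K (X j)) + (s \ J).card) :
    ∃ v : ν → V, (∀ j, v j ∈ X j) ∧
      N ≤ finrank K ↥(W ⊔ s.sup fun j => Submodule.span K {v j}) := by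
  induction s using Finset.induction_on generalizing W with
  | empty =>
    choose v hv using hX
    exact ⟨v, hv, h ∅ subset_rfl⟩
  | insert k s hk ih =>
    obtain ⟨w, hw, hN⟩ := exists_mem_forall_le_finrank_sup_span_singleton (hX k)
      (fun J hJ => by
        have hN := h J (hJ.trans (Finset.subset_insert k s))
        rwa [Finset.insert_sdiff_of_notMem _ fun hkJ => hk (hJ hkJ), Finset.card_insert_of_notMem
          fun hks => hk (Finset.mem_sdiff.1 hks).1, ← add_assoc] at hN)
      (fun J hJ => by
        have hN := h (insert k J) (Finset.insert_subset_insert k hJ)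
        rwa [Finset.sup_insert, ← sup_assoc, Finset.insert_sdiff_insert,
          Finset.sdiff_insert_of_notMem hk] at hN)
    obtain ⟨v, hv, hle⟩ := ih hN
    refine ⟨Function.update v k w,
      (Function.forall_update_iff v fun j u => u ∈ X j).2 ⟨hw, fun j _ => hv j⟩, ?_⟩
    rwa [Finset.sup_insert, Function.update_self, ← sup_assoc, Finset.sup_congr rfl fun j hj => by
      rw [Function.update_of_ne (ne_of_mem_of_not_mem hj hk)]]

end Transversal

theorem eq_zero_of_degreeOf_le_one {R σ : Type*} [CommRing R] [IsDomain R] {p : MvPolynomial σ R}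
    (hp : ∀ i, p.degreeOf i ≤ 1) (h : ∀ x, eval x p = 0) : p = 0 := by
  classical
  obtain ⟨s, q, rfl⟩ := exists_finset_rename p
  have hq : q = 0 := by
    refine eq_zero_of_eval_zero_at_prod_finset q (fun _ => {0, 1}) (fun i => ?_) fun x _ => ?_
    · rw [Finset.card_pair zero_ne_one, ← degreeOf_rename_of_injective Subtype.val_injective]
      exact Nat.lt_succ_of_le (hp i)
    · rw [← h (Function.extend Subtype.val x 0), eval_rename,
        Function.extend_comp Subtype.val_injective]
  rw [hq, map_zero]

section ConstantMatrix

variable {F μ ν κ τ : Type*} [Field F] [Fintype ν]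

theorem rank_add_finrank_ker_mulVecLin (M : Matrix μ ν F) :
    M.rank + finrank F (LinearMap.ker M.mulVecLin) = Fintype.card ν := by
  rw [Matrix.rank, LinearMap.finrank_range_add_finrank_ker, finrank_fintype_fun_eq_card]

theorem rank_eq_rank_iff_forall_mulVec_eq_zero {M : Matrix μ ν F} {N : Matrix κ ν F}
    (h : ∀ c, M *ᵥ c = 0 → N *ᵥ c = 0) :
    N.rank = M.rank ↔ ∀ c, N *ᵥ c = 0 → M *ᵥ c = 0 := by
  have hle : LinearMap.ker M.mulVecLin ≤ LinearMap.ker N.mulVecLin := h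
  have hM := rank_add_finrank_ker_mulVecLin M
  have hN := rank_add_finrank_ker_mulVecLin N
  refine ⟨fun hrank => (Submodule.eq_of_le_of_finrank_eq hle (by omega)).ge, fun hge => ?_⟩
  rw [le_antisymm hge hle] at hN
  omega

theorem rank_eq_card_width_iff {M : Matrix μ ν F} :
    M.rank = Fintype.card ν ↔ ∀ c, M *ᵥ c = 0 → c = 0 := by
  rw [← rank_add_finrank_ker_mulVecLin M, left_eq_add, Submodule.finrank_eq_zero,
    LinearMap.ker_eq_bot']
  rfl

theorem rank_eq_card_height_iff [Fintype μ] {M : Matrix μ ν F} :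
    M.rank = Fintype.card μ ↔ Function.Surjective M.mulVec := by
  rw [Matrix.rank, ← finrank_fintype_fun_eq_card F]
  exact Iff.trans ⟨Submodule.eq_top_of_finrank_eq, fun h => by rw [h, finrank_top]⟩
    LinearMap.range_eq_top

theorem rank_fromCols_le [Fintype τ] (M : Matrix μ ν F) (N : Matrix μ τ F) :
    (Matrix.fromCols M N).rank ≤ M.rank + N.rank := by
  refine (Submodule.finrank_mono ?_).trans (Submodule.finrank_add_le_finrank_add_finrank
    (LinearMap.range M.mulVecLin) (LinearMap.range N.mulVecLin))
  rintro _ ⟨c, rfl⟩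
  rw [Matrix.mulVecLin_apply, Matrix.fromCols_mulVec]
  exact Submodule.add_mem_sup ⟨_, rfl⟩ ⟨_, rfl⟩

theorem rank_fromRows_le [Finite μ] [Finite κ] (M : Matrix μ ν F) (N : Matrix κ ν F) :
    (Matrix.fromRows M N).rank ≤ M.rank + N.rank := by
  cases nonempty_fintype μ
  cases nonempty_fintype κ
  rw [← Matrix.rank_transpose, Matrix.transpose_fromRows, ← M.rank_transpose, ← N.rank_transpose]
  exact rank_fromCols_le _ _

theorem rank_fromBlocks_zero₂₁_le_rank_add_card [Finite μ] [Finite κ] [Fintype τ]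
    (B : Matrix μ ν F) (X : Matrix μ τ F) (D : Matrix κ τ F) :
    (Matrix.fromBlocks B X 0 D).rank ≤ B.rank + Fintype.card τ :=
  calc (Matrix.fromBlocks B X 0 D).rank
      ≤ (Matrix.fromRows B 0).rank + (Matrix.fromRows X D).rank := by
        rw [← Matrix.fromCols_fromRows_eq_fromBlocks]; exact rank_fromCols_le _ _
    _ ≤ B.rank + (0 : Matrix κ ν F).rank + Fintype.card τ :=
        add_le_add (rank_fromRows_le _ _) (Matrix.rank_le_card_width _)
    _ = B.rank + Fintype.card τ := by rw [Matrix.rank_zero, add_zero]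

theorem rank_fromBlocks_zero₂₁_le_card_add_rank [Fintype μ] [Finite κ] [Fintype τ]
    (B : Matrix μ ν F) (X : Matrix μ τ F) (D : Matrix κ τ F) :
    (Matrix.fromBlocks B X 0 D).rank ≤ Fintype.card μ + D.rank :=
  calc (Matrix.fromBlocks B X 0 D).rank
      ≤ (Matrix.fromCols B X).rank + (Matrix.fromCols 0 D).rank := by
        rw [← Matrix.fromRows_fromCols_eq_fromBlocks]; exact rank_fromRows_le _ _
    _ ≤ Fintype.card μ + ((0 : Matrix κ ν F).rank + D.rank) :=
        add_le_add (Matrix.rank_le_card_height _) (rank_fromCols_le _ _)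
    _ = Fintype.card μ + D.rank := by rw [Matrix.rank_zero, zero_add]

theorem card_add_card_le_rank_fromBlocks_zero₂₁ [Fintype μ] [Finite κ] [Fintype τ]
    {B : Matrix μ ν F} (X : Matrix μ τ F) {D : Matrix κ τ F} (hB : B.rank = Fintype.card μ)
    (hD : D.rank = Fintype.card τ) :
    Fintype.card μ + Fintype.card τ ≤ (Matrix.fromBlocks B X 0 D).rank := by
  classical
  cases nonempty_fintype κ
  obtain ⟨B', hB'⟩ := Matrix.mulVec_surjective_iff_exists_right_inverse.1
    (rank_eq_card_height_iff.1 hB)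
  obtain ⟨D', hD'⟩ : ∃ D' : Matrix τ κ F, D' * D = 1 := by
    rw [← D.rank_transpose, rank_eq_card_height_iff, funext D.mulVec_transpose] at hD
    exact Matrix.vecMul_surjective_iff_exists_left_inverse.1 hD
  have hmul : Matrix.fromBlocks (1 : Matrix μ μ F) 0 0 D' * Matrix.fromBlocks B X 0 D *
      Matrix.fromBlocks B' 0 0 (1 : Matrix τ τ F) = Matrix.fromBlocks 1 X 0 1 := by
    simp [Matrix.fromBlocks_multiply, hB', hD']
  calc Fintype.card μ + Fintype.card τ = (Matrix.fromBlocks 1 X 0 1).rank := by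
        rw [Matrix.rank_of_det_ne_zero (by simp), Fintype.card_sum]
    _ ≤ (Matrix.fromBlocks (1 : Matrix μ μ F) 0 0 D' * Matrix.fromBlocks B X 0 D).rank := by
        rw [← hmul]; exact Matrix.rank_mul_le_left _ _
    _ ≤ (Matrix.fromBlocks B X 0 D).rank := Matrix.rank_mul_le_right _ _

theorem rank_fromBlocks_zero₂₁_eq_iff [Fintype μ] [Finite κ] [Fintype τ]
    {B : Matrix μ ν F} {X : Matrix μ τ F} {D : Matrix κ τ F} :
    (Matrix.fromBlocks B X 0 D).rank = Fintype.card μ + Fintype.card τ ↔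
      B.rank = Fintype.card μ ∧ D.rank = Fintype.card τ := by
  cases nonempty_fintype κ
  have hB := rank_fromBlocks_zero₂₁_le_rank_add_card B X D
  have hD := rank_fromBlocks_zero₂₁_le_card_add_rank B X D
  have hμ := B.rank_le_card_height
  have hτ := D.rank_le_card_width
  refine ⟨fun h => by omega, fun h => ?_⟩
  have hge := card_add_card_le_rank_fromBlocks_zero₂₁ X h.1 h.2
  omega

theorem mulVec_eq_deleteCol_mulVec_add_smul [DecidableEq ν] (M : Matrix μ ν F) (j : ν) (c : ν → F) :
    M *ᵥ c = deleteCol M j *ᵥ (c ∘ Subtype.val) + c j • M.col j := by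
  ext i
  rw [Matrix.mulVec, dotProduct, Fintype.sum_eq_add_sum_subtype_ne _ j, add_comm, mul_comm]
  rfl

theorem rank_deleteCol_eq_iff [DecidableEq ν] {M : Matrix μ ν F} {j : ν} :
    (deleteCol M j).rank = M.rank ↔ ∃ c, M *ᵥ c = 0 ∧ c j ≠ 0 := by
  have mulVec_extend (c : {k // k ≠ j} → F) (a : F) :
      M *ᵥ Function.extend Subtype.val c (fun _ => a) = deleteCol M j *ᵥ c + a • M.col j := by
    rw [mulVec_eq_deleteCol_mulVec_add_smul M j, Function.extend_comp Subtype.val_injective,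
      Function.extend_apply' _ _ _ (by simp)]
  have hle : LinearMap.range (deleteCol M j).mulVecLin ≤ LinearMap.range M.mulVecLin := by
    rintro _ ⟨c, rfl⟩
    exact ⟨_, (mulVec_extend c 0).trans (by rw [zero_smul, add_zero]; rfl)⟩
  constructor
  · intro h
    obtain ⟨c, hc⟩ : M.col j ∈ LinearMap.range (deleteCol M j).mulVecLin := by
      rw [Submodule.eq_of_le_of_finrank_eq hle h]
      exact ⟨Pi.single j 1, M.mulVec_single_one j⟩
    refine ⟨Function.extend Subtype.val c fun _ => -1, ?_, ?_⟩
    · rw [mulVec_extend, ← Matrix.mulVecLin_apply, hc, neg_one_smul, add_neg_cancel]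
    · rw [Function.extend_apply' _ _ _ (by simp)]
      exact neg_ne_zero.2 one_ne_zero
  · rintro ⟨c, hc, hcj⟩
    refine (Submodule.finrank_mono hle).antisymm (Submodule.finrank_mono ?_)
    rintro _ ⟨d, rfl⟩
    refine ⟨(d - (d j / c j) • c) ∘ Subtype.val, ?_⟩
    have hd : M *ᵥ (d - (d j / c j) • c) = M *ᵥ d := by
      rw [Matrix.mulVec_sub, Matrix.mulVec_smul, hc, smul_zero, sub_zero]
    rw [mulVec_eq_deleteCol_mulVec_add_smul M j] at hd
    simpa [hcj] using hd

theorem rank_deleteRow_eq_iff [DecidableEq μ] {M : Matrix μ ν F} {i : μ} :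
    (deleteRow M i).rank = M.rank ↔ ¬ ∃ c, M *ᵥ c = Pi.single i 1 := by
  have hdel (c) : deleteRow M i *ᵥ c = 0 ↔ ∀ k, k ≠ i → (M *ᵥ c) k = 0 := by
    rw [funext_iff, Subtype.forall]
    rfl
  rw [rank_eq_rank_iff_forall_mulVec_eq_zero fun c hc => (hdel c).2 fun k _ => congrFun hc k]
  constructor
  · rintro h ⟨c, hc⟩
    have h0 := h c ((hdel c).2 fun k hk => by rw [hc, Pi.single_eq_of_ne hk])
    rw [hc, Pi.single_eq_zero_iff] at h0
    exact one_ne_zero h0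
  · intro h c hc
    rw [hdel] at hc
    by_contra hne
    have hci : (M *ᵥ c) i ≠ 0 := fun hi => hne (funext fun k => by
      obtain rfl | hk := eq_or_ne k i
      exacts [hi, hc k hk])
    refine h ⟨((M *ᵥ c) i)⁻¹ • c, funext fun k => ?_⟩
    rw [Matrix.mulVec_smul, Pi.smul_apply, smul_eq_mul]
    obtain rfl | hk := eq_or_ne k i
    · rw [Pi.single_eq_same, inv_mul_cancel₀ hci]
    · rw [Pi.single_eq_of_ne hk, hc k hk, mul_zero]

theorem rank_fromCols_replicateCol_eq_iff {M : Matrix μ ν F} {v : μ → F}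
    (hM : M.rank = Fintype.card ν) :
    (Matrix.fromCols M (Matrix.replicateCol Unit v)).rank = Fintype.card ν + 1 ↔
      ¬ ∃ c, M *ᵥ c = v := by
  have mulVec_eq (c : ν ⊕ Unit → F) : Matrix.fromCols M (Matrix.replicateCol Unit v) *ᵥ c =
      M *ᵥ (c ∘ Sum.inl) + c (Sum.inr ()) • v := by
    rw [Matrix.fromCols_mulVec]
    congr 1
    ext i
    simp [Matrix.mulVec, dotProduct, mul_comm]
  rw [rank_eq_card_width_iff] at hM
  rw [← Fintype.card_unit, ← Fintype.card_sum, rank_eq_card_width_iff]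
  constructor
  · rintro h ⟨c, hc⟩
    have h0 := h (Sum.elim c fun _ => -1) (by simp [mulVec_eq, hc])
    simpa using congrFun h0 (Sum.inr ())
  · intro h c hc
    rw [mulVec_eq] at hc
    have hinr : c (Sum.inr ()) = 0 := by
      by_contra hne
      refine h ⟨-(c (Sum.inr ()))⁻¹ • (c ∘ Sum.inl), ?_⟩
      rw [Matrix.mulVec_smul, eq_neg_of_add_eq_zero_left hc, smul_neg, neg_smul, neg_neg,
        inv_smul_smul₀ hne]
    rw [hinr, zero_smul, add_zero] at hc
    ext (k | _)
    exacts [congrFun (hM _ hc) k, hinr]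

end ConstantMatrix

section Family

variable {F ι μ ν κ τ : Type*} [Field F] [Fintype ν]

/-- A family of matrices has essential columns if each column of some member lies outside the span
of the other columns of that member: equivalently (`rank_deleteCol_eq_iff`), the deletion of a
column never preserves the ranks of all the members. -/
def HasEssentialCols (M : ι → Matrix μ ν F) : Prop :=
  ∀ j, ∃ x, ∀ c, M x *ᵥ c = 0 → c j = 0

/-- The column spaces of the members of a family of matrices cover the whole space. For the
completions of an ACI-matrix of constant rank, this says that no matrix equivalent to it is row
reducible. -/
def ColSpacesCover (M : ι → Matrix μ ν F) : Prop :=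
  ∀ w, ∃ x c, M x *ᵥ c = w

theorem hasEssentialCols_iff_forall_exists_rank_deleteCol_ne [DecidableEq ν]
    {M : ι → Matrix μ ν F} :
    HasEssentialCols M ↔ ∀ j, ∃ x, (deleteCol (M x) j).rank ≠ (M x).rank := by
  simp only [HasEssentialCols, ne_eq, rank_deleteCol_eq_iff, not_exists, not_and, not_not]

theorem HasEssentialCols.submatrix {M : ι → Matrix μ ν F} [Fintype τ] (h : HasEssentialCols M)
    (e : κ ≃ μ) (f : τ ≃ ν) : HasEssentialCols fun x => (M x).submatrix e f := by
  intro j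
  obtain ⟨x, hx⟩ := h (f j)
  refine ⟨x, fun c hc => ?_⟩
  rw [Matrix.submatrix_mulVec_equiv] at hc
  simpa using hx _ (e.surjective.injective_comp_right hc)

theorem hasEssentialCols_submatrix_iff [Fintype τ] {M : ι → Matrix μ ν F} (e : κ ≃ μ)
    (f : τ ≃ ν) : HasEssentialCols (fun x => (M x).submatrix e f) ↔ HasEssentialCols M :=
  ⟨fun h => by simpa using h.submatrix e.symm f.symm, fun h => h.submatrix e f⟩

theorem hasEssentialCols_mul_iff [Fintype μ] [DecidableEq μ] {M : ι → Matrix μ ν F}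
    {T : Matrix μ μ F} (hT : IsUnit T) :
    HasEssentialCols (fun x => T * M x) ↔ HasEssentialCols M := by
  have mulVec_eq_zero_iff (v : μ → F) : T *ᵥ v = 0 ↔ v = 0 :=
    (Matrix.mulVec_injective_of_isUnit hT).eq_iff' T.mulVec_zero
  simp only [HasEssentialCols, ← Matrix.mulVec_mulVec, mulVec_eq_zero_iff]

theorem colSpacesCover_submatrix_iff [Fintype τ] {M : ι → Matrix μ ν F} (e : κ ≃ μ)
    (f : τ ≃ ν) : ColSpacesCover (fun x => (M x).submatrix e f) ↔ ColSpacesCover M := by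
  simp only [ColSpacesCover, Matrix.submatrix_mulVec_equiv]
  rw [e.injective.surjective_comp_right.forall]
  simp only [e.surjective.injective_comp_right.eq_iff,
    f.symm.injective.surjective_comp_right.exists]

theorem colSpacesCover_mul_iff [Fintype μ] [DecidableEq μ] {M : ι → Matrix μ ν F}
    {T : Matrix μ μ F} (hT : IsUnit T) :
    ColSpacesCover (fun x => T * M x) ↔ ColSpacesCover M := by
  simp only [ColSpacesCover, ← Matrix.mulVec_mulVec]
  rw [(Matrix.mulVec_surjective_iff_isUnit.2 hT).forall]
  simp only [(Matrix.mulVec_injective_of_isUnit hT).eq_iff]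

theorem hasEssentialCols_fromBlocks_iff [Nonempty ι] [Fintype τ] {B : ι → Matrix μ ν F}
    {X : ι → Matrix μ τ F} {D : ι → Matrix κ τ F} (hD : ∀ x, (D x).rank = Fintype.card τ) :
    HasEssentialCols (fun x => Matrix.fromBlocks (B x) (X x) 0 (D x)) ↔ HasEssentialCols B := by
  have fromBlocks_mulVec_eq_zero (x) (c : ν ⊕ τ → F)
      (hc : Matrix.fromBlocks (B x) (X x) 0 (D x) *ᵥ c = 0) :
      B x *ᵥ (c ∘ Sum.inl) = 0 ∧ c ∘ Sum.inr = 0 := by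
    rw [Matrix.fromBlocks_mulVec, Matrix.zero_mulVec, zero_add] at hc
    have hinr : c ∘ Sum.inr = 0 :=
      rank_eq_card_width_iff.1 (hD x) _ (by simpa using congrArg (· ∘ Sum.inr) hc)
    rw [hinr, Matrix.mulVec_zero, add_zero] at hc
    exact ⟨by simpa using congrArg (· ∘ Sum.inl) hc, hinr⟩
  constructor
  · intro h j
    obtain ⟨x, hx⟩ := h (Sum.inl j)
    refine ⟨x, fun c hc => hx (Sum.elim c 0) ?_⟩
    rw [Matrix.fromBlocks_mulVec, Sum.elim_comp_inl, Sum.elim_comp_inr, hc]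
    simp
  · rintro h (j | j)
    · obtain ⟨x, hx⟩ := h j
      exact ⟨x, fun c hc => hx _ (fromBlocks_mulVec_eq_zero x c hc).1⟩
    · exact ⟨Classical.arbitrary ι, fun c hc =>
        congrFun (fromBlocks_mulVec_eq_zero _ c hc).2 j⟩

theorem colSpacesCover_fromBlocks_iff [Fintype μ] [Fintype τ] {B : ι → Matrix μ ν F}
    {X : ι → Matrix μ τ F} {D : ι → Matrix κ τ F} (hB : ∀ x, (B x).rank = Fintype.card μ) :
    ColSpacesCover (fun x => Matrix.fromBlocks (B x) (X x) 0 (D x)) ↔ ColSpacesCover D := by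
  constructor
  · intro h w
    obtain ⟨x, c, hc⟩ := h (Sum.elim 0 w)
    refine ⟨x, c ∘ Sum.inr, ?_⟩
    simpa [Matrix.fromBlocks_mulVec] using congrArg (· ∘ Sum.inr) hc
  · intro h w
    obtain ⟨x, c, hc⟩ := h (w ∘ Sum.inr)
    obtain ⟨b, hb⟩ := rank_eq_card_height_iff.1 (hB x) (w ∘ Sum.inl - X x *ᵥ c)
    refine ⟨x, Sum.elim b c, ?_⟩
    rw [Matrix.fromBlocks_mulVec, Sum.elim_comp_inl, Sum.elim_comp_inr, hb, hc, sub_add_cancel,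
      Matrix.zero_mulVec, zero_add, Sum.elim_comp_inl_inr]

end Family

section Completion

variable {F σ μ ν : Type*} [Field F] {A : Matrix μ ν (MvPolynomial σ F)}

theorem hasConstantRank_iff [Fintype ν] {ρ : ℕ} :
    HasConstantRank A ρ ↔ ∀ x, (completion A x).rank = ρ := by
  rw [HasConstantRank, rankSet, Set.range_eq_singleton_iff]

theorem HasConstantRank.unique [Fintype ν] {ρ ρ' : ℕ} (h : HasConstantRank A ρ)
    (h' : HasConstantRank A ρ') : ρ = ρ' :=
  Set.singleton_injective (h.symm.trans h')

theorem completion_deleteRow (A : Matrix μ ν (MvPolynomial σ F)) (i : μ) (x : σ → F) :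
    completion (deleteRow A i) x = deleteRow (completion A x) i := rfl

theorem completion_deleteCol (A : Matrix μ ν (MvPolynomial σ F)) (j : ν) (x : σ → F) :
    completion (deleteCol A j) x = deleteCol (completion A x) j := rfl

theorem completion_augment (A : Matrix μ ν (MvPolynomial σ F)) (v : μ → F) (x : σ → F) :
    completion (augment A v) x =
      Matrix.fromCols (completion A x) (Matrix.replicateCol Unit v) := by
  ext i (j | j) <;> simp [completion, augment]

theorem IsACI.exists_completion_col_eq (hA : IsACI A) (y : ν → σ → F) :
    ∃ x, ∀ j, (completion A x).col j = (completion A (y j)).col j := by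
  classical
  refine ⟨fun k => if h : ∃ j i, k ∈ (A i j).vars then y h.choose k else 0, fun j => ?_⟩
  ext i
  refine eval₂Hom_congr' rfl (fun k hk _ => ?_) rfl
  have h : ∃ j i, k ∈ (A i j).vars := ⟨j, i, hk⟩
  have hj : h.choose = j := by
    by_contra hne
    obtain ⟨i', hi'⟩ := h.choose_spec
    exact hA.independent _ _ hne i' i k hi' hk
  simp only [dif_pos h, hj]

/-- The span of all the completions of a column. The join of these spans over a set `J` of columns
is the space `U_J` whose straightening gives the block triangular form. -/
def colSpan (A : Matrix μ ν (MvPolynomial σ F)) (j : ν) : Submodule F (μ → F) :=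
  Submodule.span F (Set.range fun x => (completion A x).col j)

theorem IsACI.exists_finrank_sup_colSpan_add_card_compl_le [Finite μ] [Fintype ν] [DecidableEq ν]
    (hA : IsACI A) {ρ : ℕ} (hr : ∀ x, (completion A x).rank ≤ ρ) :
    ∃ J : Finset ν, finrank F ↥(J.sup (colSpan A)) + Jᶜ.card ≤ ρ := by
  by_contra! h
  have hJ (J) (_ : J ⊆ Finset.univ) :
      ρ + 1 ≤ finrank F ↥(⊥ ⊔ J.sup (colSpan A)) + (Finset.univ \ J).card := by
    rw [bot_sup_eq, ← Finset.compl_eq_univ_sdiff]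
    exact h J
  obtain ⟨v, hv, hle⟩ := exists_transversal_le_finrank (fun j => Set.range_nonempty _) hJ
  choose y hy using hv
  obtain ⟨x, hx⟩ := hA.exists_completion_col_eq y
  obtain rfl : (completion A x).col = v := by
    ext1 j
    rw [hx, ← hy]
  rw [bot_sup_eq, Finset.sup_univ_eq_iSup, ← Submodule.span_range_eq_iSup,
    ← Matrix.rank_eq_finrank_span_cols] at hle
  exact absurd (hle.trans (hr x)) ρ.not_succ_le_self

end Completion

section Equivalent

variable {F σ μ ν : Type*} [Field F] [Fintype μ] {A B : Matrix μ ν (MvPolynomial σ F)}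

theorem completion_mul_submatrix (A : Matrix μ ν (MvPolynomial σ F)) (T : Matrix μ μ F)
    (f : ν → ν) (x : σ → F) :
    completion ((T.map (C : F →+* MvPolynomial σ F) * A).submatrix id f) x =
      T * (completion A x).submatrix id f := by
  ext i j
  simp [completion, Matrix.mul_apply]

theorem IsACI.mul_submatrix (hA : IsACI A) (T : Matrix μ μ F) {f : ν → ν}
    (hf : Function.Injective f) :
    IsACI ((T.map (C : F →+* MvPolynomial σ F) * A).submatrix id f) := by
  classical
  have exists_mem_vars {i j k}
      (hk : k ∈ ((T.map (C : F →+* MvPolynomial σ F) * A).submatrix id f i j).vars) :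
      ∃ l, k ∈ (A l (f j)).vars := by
    rw [Matrix.submatrix_apply, Matrix.mul_apply] at hk
    obtain ⟨l, -, hl⟩ := Finset.mem_biUnion.1 (vars_sum_subset _ _ hk)
    exact ⟨l, by simpa using vars_mul _ _ hl⟩
  constructor
  · intro i j
    rw [Matrix.submatrix_apply, Matrix.mul_apply]
    refine totalDegree_finsetSum_le fun l _ => (totalDegree_mul _ _).trans ?_
    simpa using hA.degree_le_one l (f j)
  · intro j j' hj i i' k hk hk'
    obtain ⟨l, hl⟩ := exists_mem_vars hk
    obtain ⟨l', hl'⟩ := exists_mem_vars hk'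
    exact hA.independent _ _ (hf.ne hj) _ _ _ hl hl'

variable [DecidableEq μ] [Fintype ν] [DecidableEq ν]

theorem IsACI.equivalent_mul_submatrix (hA : IsACI A) {T : Matrix μ μ F} (hT : IsUnit T)
    (f : Equiv.Perm ν) :
    Equivalent A ((T.map (C : F →+* MvPolynomial σ F) * A).submatrix id f) :=
  ⟨hA, hA.mul_submatrix T f.injective, T, f.symm, ((Matrix.isUnit_iff_isUnit_det T).1 hT).ne_zero,
    PEquiv.mul_toMatrix_toPEquiv _ f.symm⟩

theorem IsACI.equivalent_refl (hA : IsACI A) : Equivalent A A :=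
  ⟨hA, hA, 1, 1, by simp, by
    rw [Matrix.map_one _ (map_zero C) (map_one C), Matrix.one_mul]
    simp⟩

theorem Equivalent.exists_completion_eq (h : Equivalent A B) :
    ∃ (T : Matrix μ μ F) (f : Equiv.Perm ν), IsUnit T ∧
      ∀ x, completion B x = T * (completion A x).submatrix id f := by
  obtain ⟨-, -, T, Q, hT, rfl⟩ := h
  refine ⟨T, Q.symm, (Matrix.isUnit_iff_isUnit_det T).2 hT.isUnit, fun x => ?_⟩
  rw [← completion_mul_submatrix]
  exact congrArg (completion · x) (PEquiv.mul_toMatrix_toPEquiv _ Q)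

theorem Equivalent.rank_completion_eq (h : Equivalent A B) (x : σ → F) :
    (completion B x).rank = (completion A x).rank := by
  obtain ⟨T, f, hT, hB⟩ := h.exists_completion_eq
  rw [hB, Matrix.rank_mul_eq_right_of_isUnit_det _ _ ((Matrix.isUnit_iff_isUnit_det T).1 hT)]
  exact Matrix.rank_submatrix _ (Equiv.refl μ) f

theorem Equivalent.hasConstantRank_iff (h : Equivalent A B) {ρ : ℕ} :
    HasConstantRank B ρ ↔ HasConstantRank A ρ := by
  simp only [ACI.hasConstantRank_iff, h.rank_completion_eq]

theorem Equivalent.hasEssentialCols_iff (h : Equivalent A B) :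
    HasEssentialCols (completion B) ↔ HasEssentialCols (completion A) := by
  obtain ⟨T, f, hT, hB⟩ := h.exists_completion_eq
  rw [funext hB, hasEssentialCols_mul_iff hT]
  exact hasEssentialCols_submatrix_iff (Equiv.refl μ) f

theorem Equivalent.colSpacesCover_iff (h : Equivalent A B) :
    ColSpacesCover (completion B) ↔ ColSpacesCover (completion A) := by
  obtain ⟨T, f, hT, hB⟩ := h.exists_completion_eq
  rw [funext hB, colSpacesCover_mul_iff hT]
  exact colSpacesCover_submatrix_iff (Equiv.refl μ) f

end Equivalent

section Irreducible

variable {F σ μ ν : Type*} [Field F] [Fintype ν] {A : Matrix μ ν (MvPolynomial σ F)} {ρ : ℕ}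

theorem HasConstantRank.isRowReducible_iff (hr : HasConstantRank A ρ) :
    IsRowReducible A ↔ ∃ i, ∀ x, (completion (deleteRow A i) x).rank = ρ := by
  simp only [← hasConstantRank_iff]
  refine ⟨fun ⟨ρ', h, i, hi⟩ => ⟨i, hr.unique h ▸ hi⟩, fun h => ⟨ρ, hr, h⟩⟩

theorem HasConstantRank.isColReducible_iff [DecidableEq ν] (hr : HasConstantRank A ρ) :
    IsColReducible A ↔ ∃ j, ∀ x, (completion (deleteCol A j) x).rank = ρ := by
  simp only [← hasConstantRank_iff]
  refine ⟨fun ⟨ρ', h, j, hj⟩ => ⟨j, hr.unique h ▸ hj⟩, fun h => ⟨ρ, hr, h⟩⟩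

theorem HasConstantRank.not_isRowReducible_iff [DecidableEq μ] (hr : HasConstantRank A ρ) :
    ¬ IsRowReducible A ↔ ∀ i, ∃ x c, completion A x *ᵥ c = Pi.single i 1 := by
  have rank_eq_iff (i x) : (deleteRow (completion A x) i).rank = ρ ↔
      ¬ ∃ c, completion A x *ᵥ c = Pi.single i 1 := by
    rw [← hasConstantRank_iff.1 hr x, rank_deleteRow_eq_iff]
  rw [hr.isRowReducible_iff]
  simp only [completion_deleteRow, rank_eq_iff, not_exists, not_forall, not_not]

variable [DecidableEq ν]

theorem HasConstantRank.not_isColReducible_iff (hr : HasConstantRank A ρ) :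
    ¬ IsColReducible A ↔ HasEssentialCols (completion A) := by
  rw [hr.isColReducible_iff, hasEssentialCols_iff_forall_exists_rank_deleteCol_ne]
  simp only [completion_deleteCol, hasConstantRank_iff.1 hr, not_exists, not_forall, ne_eq]

theorem HasConstantRank.isIrreducible_iff [DecidableEq μ] (hr : HasConstantRank A ρ) :
    IsIrreducible A ↔ HasEssentialCols (completion A) ∧
      ∀ i, ∃ x c, completion A x *ᵥ c = Pi.single i 1 := by
  rw [IsIrreducible, hr.not_isColReducible_iff, hr.not_isRowReducible_iff, and_comm (a := ∀ _, _)]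
  exact and_iff_right ⟨ρ, hr⟩

theorem exists_isUnit_mulVec_eq_single [Fintype μ] [DecidableEq μ] {w : μ → F} {i : μ}
    (hw : w i ≠ 0) : ∃ T : Matrix μ μ F, IsUnit T ∧ T *ᵥ w = Pi.single i 1 := by
  let S := (1 : Matrix μ μ F).updateCol i w
  have hS : IsUnit S.det := by
    rw [← Matrix.cramer_apply, Matrix.cramer_one]
    exact hw.isUnit
  have hSw : S *ᵥ Pi.single i 1 = w := by
    ext k
    simp [S]
  exact ⟨S⁻¹, Matrix.isUnit_nonsing_inv_iff.2 ((Matrix.isUnit_iff_isUnit_det S).2 hS), by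
    rw [← hSw, Matrix.mulVec_mulVec, Matrix.nonsing_inv_mul _ hS, Matrix.one_mulVec]⟩

theorem IsACI.isCompletelyIrreducible_iff [Fintype μ] [DecidableEq μ] (hA : IsACI A)
    (hr : HasConstantRank A ρ) :
    IsCompletelyIrreducible A ↔
      HasEssentialCols (completion A) ∧ ColSpacesCover (completion A) := by
  constructor
  · rintro ⟨-, h⟩
    have irreducible_conditions (B) (hB : Equivalent A B) :=
      (hB.hasConstantRank_iff.2 hr).isIrreducible_iff.1 (h B hB)
    refine ⟨(irreducible_conditions A hA.equivalent_refl).1, fun w => ?_⟩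
    by_cases hw : w = 0
    · exact ⟨0, 0, by rw [hw, Matrix.mulVec_zero]⟩
    obtain ⟨i, hi⟩ := Function.ne_iff.1 hw
    obtain ⟨T, hT, hTw⟩ := exists_isUnit_mulVec_eq_single hi
    obtain ⟨x, c, hc⟩ :=
      (irreducible_conditions _ (hA.equivalent_mul_submatrix hT (Equiv.refl ν))).2 i
    refine ⟨x, c, Matrix.mulVec_injective_of_isUnit hT ?_⟩
    rw [hTw, ← hc, completion_mul_submatrix, Matrix.mulVec_mulVec]
    rfl
  · rintro ⟨hcols, hcover⟩
    refine ⟨⟨ρ, hr⟩, fun B hB => (hB.hasConstantRank_iff.2 hr).isIrreducible_iff.2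
      ⟨hB.hasEssentialCols_iff.2 hcols, fun i => hB.colSpacesCover_iff.2 hcover _⟩⟩

end Irreducible

section FullRank

variable {F σ μ ν : Type*} [Field F] [Fintype μ] [Fintype ν] {A : Matrix μ ν (MvPolynomial σ F)}

theorem isMinimalFullRank_iff [DecidableEq ν] :
    IsMinimalFullRank A ↔ Fintype.card μ < Fintype.card ν ∧
      HasConstantRank A (Fintype.card μ) ∧ HasEssentialCols (completion A) := by
  rw [IsMinimalFullRank, IsFullRank, and_left_comm]
  refine and_congr_right fun hcard => ?_
  rw [min_eq_left hcard.le]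
  refine and_congr_right fun hr => ?_
  simp only [hasEssentialCols_iff_forall_exists_rank_deleteCol_ne, IsFullRank,
    Fintype.card_subtype_compl, Fintype.card_subtype_eq, min_eq_left (Nat.le_sub_one_of_lt hcard),
    hasConstantRank_iff, not_forall, completion_deleteCol, hasConstantRank_iff.1 hr, ne_eq]

theorem isMaximalFullRank_iff :
    IsMaximalFullRank A ↔ Fintype.card ν < Fintype.card μ ∧
      HasConstantRank A (Fintype.card ν) ∧ ColSpacesCover (completion A) := by
  rw [IsMaximalFullRank, IsFullRank, and_left_comm]
  refine and_congr_right fun hcard => ?_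
  rw [min_eq_right hcard.le]
  refine and_congr_right fun hr => ?_
  simp only [ColSpacesCover, IsFullRank, Fintype.card_sum, Fintype.card_unit,
    min_eq_right (Nat.succ_le_of_lt hcard), hasConstantRank_iff, completion_augment,
    rank_fromCols_replicateCol_eq_iff (hasConstantRank_iff.1 hr _), not_forall, not_not]

theorem IsMinimalFullRank.card_pos [DecidableEq ν] (h : IsMinimalFullRank A) :
    0 < Fintype.card μ := by
  obtain ⟨hcard, -, hcols⟩ := isMinimalFullRank_iff.1 h
  obtain ⟨j⟩ : Nonempty ν := Fintype.card_pos_iff.1 (Nat.zero_lt_of_lt hcard)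
  obtain ⟨x, hx⟩ := hcols j
  by_contra hμ
  have : IsEmpty μ := Fintype.card_eq_zero_iff.1 (Nat.eq_zero_of_not_pos hμ)
  simpa using hx (Pi.single j 1) (Subsingleton.elim _ _)

theorem IsMaximalFullRank.card_pos (h : IsMaximalFullRank A) : 0 < Fintype.card ν := by
  obtain ⟨hcard, -, hcover⟩ := isMaximalFullRank_iff.1 h
  obtain ⟨i⟩ : Nonempty μ := Fintype.card_pos_iff.1 (Nat.zero_lt_of_lt hcard)
  obtain ⟨x, c, hc⟩ := hcover 1
  by_contra hν
  have : IsEmpty ν := Fintype.card_eq_zero_iff.1 (Nat.eq_zero_of_not_pos hν)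
  have hci : (completion A x *ᵥ c) i = 0 := Matrix.dotProduct_of_isEmpty _ _
  exact zero_ne_one (hci.symm.trans (congrFun hc i))

end FullRank

section BlockUpper

variable {F σ : Type*} [Field F] {m n p q r s : ℕ} {hm : p + r = m} {hn : q + s = n}
  {A : Matrix (Fin m) (Fin n) (MvPolynomial σ F)}
  {A₁₁ : Matrix (Fin p) (Fin q) (MvPolynomial σ F)}
  {A₁₂ : Matrix (Fin p) (Fin s) (MvPolynomial σ F)}
  {A₂₂ : Matrix (Fin r) (Fin s) (MvPolynomial σ F)}

theorem completion_blockUpper (x : σ → F) :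
    completion (blockUpper hm hn A₁₁ A₁₂ A₂₂) x =
      (Matrix.fromBlocks (completion A₁₁ x) (completion A₁₂ x) 0 (completion A₂₂ x)).submatrix
        (finSumFinEquiv.trans (finCongr hm)).symm (finSumFinEquiv.trans (finCongr hn)).symm := by
  rw [blockUpper, Matrix.reindex_apply, completion, ← Matrix.submatrix_map, Matrix.fromBlocks_map,
    Matrix.map_zero _ (map_zero _)]
  rfl

theorem rank_completion_blockUpper (x : σ → F) :
    (completion (blockUpper hm hn A₁₁ A₁₂ A₂₂) x).rank =
      (Matrix.fromBlocks (completion A₁₁ x) (completion A₁₂ x) 0 (completion A₂₂ x)).rank := by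
  rw [completion_blockUpper, Matrix.rank_submatrix]

theorem rank_completion_blockUpper_le (x : σ → F) :
    (completion (blockUpper hm hn A₁₁ A₁₂ A₂₂) x).rank ≤ p + s := by
  have hle := rank_fromBlocks_zero₂₁_le_rank_add_card (completion A₁₁ x) (completion A₁₂ x)
    (completion A₂₂ x)
  rw [← rank_completion_blockUpper (hm := hm) (hn := hn), Fintype.card_fin] at hle
  exact hle.trans (Nat.add_le_add_right (Matrix.rank_le_height _) s)

theorem hasConstantRank_blockUpper_iff :
    HasConstantRank (blockUpper hm hn A₁₁ A₁₂ A₂₂) (p + s) ↔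
      HasConstantRank A₁₁ p ∧ HasConstantRank A₂₂ s := by
  simp only [hasConstantRank_iff, rank_completion_blockUpper, ← forall_and]
  refine forall_congr' fun x => ?_
  simpa only [Fintype.card_fin] using rank_fromBlocks_zero₂₁_eq_iff (B := completion A₁₁ x)
    (X := completion A₁₂ x) (D := completion A₂₂ x)

theorem hasEssentialCols_blockUpper_iff (h₂ : HasConstantRank A₂₂ s) :
    HasEssentialCols (completion (blockUpper hm hn A₁₁ A₁₂ A₂₂)) ↔
      HasEssentialCols (completion A₁₁) := by
  rw [_root_.funext completion_blockUpper, hasEssentialCols_submatrix_iff,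
    hasEssentialCols_fromBlocks_iff (by simpa using hasConstantRank_iff.1 h₂)]

theorem colSpacesCover_blockUpper_iff (h₁ : HasConstantRank A₁₁ p) :
    ColSpacesCover (completion (blockUpper hm hn A₁₁ A₁₂ A₂₂)) ↔
      ColSpacesCover (completion A₂₂) := by
  rw [_root_.funext completion_blockUpper, colSpacesCover_submatrix_iff,
    colSpacesCover_fromBlocks_iff (by simpa using hasConstantRank_iff.1 h₁)]

theorem Equivalent.isCompletelyIrreducible_iff_of_blockUpper
    (h : Equivalent A (blockUpper hm hn A₁₁ A₁₂ A₂₂)) (hpq : p < q) (hsr : s < r)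
    (h₁ : HasConstantRank A₁₁ p) (h₂ : HasConstantRank A₂₂ s) :
    IsCompletelyIrreducible A ↔ IsMinimalFullRank A₁₁ ∧ IsMaximalFullRank A₂₂ := by
  have hr := h.hasConstantRank_iff.1 (hasConstantRank_blockUpper_iff.2 ⟨h₁, h₂⟩)
  rw [h.1.isCompletelyIrreducible_iff hr, ← h.hasEssentialCols_iff, ← h.colSpacesCover_iff,
    hasEssentialCols_blockUpper_iff h₂, colSpacesCover_blockUpper_iff h₁, isMinimalFullRank_iff,
    isMaximalFullRank_iff]
  simp only [Fintype.card_fin, hpq, hsr, h₁, h₂, true_and]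

theorem exists_eq_blockUpper {R : Type*} [Zero R] {N : Matrix (Fin (p + r)) (Fin (q + s)) R}
    (hN : ∀ i j, N (Fin.natAdd p i) (Fin.castAdd s j) = 0) :
    ∃ (N₁₁ : Matrix (Fin p) (Fin q) R) (N₁₂ : Matrix (Fin p) (Fin s) R)
      (N₂₂ : Matrix (Fin r) (Fin s) R), N = blockUpper rfl rfl N₁₁ N₁₂ N₂₂ := by
  refine ⟨N.submatrix (Fin.castAdd r) (Fin.castAdd s), N.submatrix (Fin.castAdd r) (Fin.natAdd q),
    N.submatrix (Fin.natAdd p) (Fin.natAdd q), ?_⟩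
  rw [blockUpper, ← Equiv.symm_apply_eq]
  ext (i | i) (j | j) : 2 <;> simp [hN]

theorem exists_isUnit_mulVec_natAdd_eq_zero (U : Submodule F (Fin (p + r) → F))
    (hU : finrank F U = p) :
    ∃ T : Matrix (Fin (p + r)) (Fin (p + r)) F, IsUnit T ∧
      ∀ u ∈ U, ∀ i : Fin r, (T *ᵥ u) (Fin.natAdd p i) = 0 := by
  obtain ⟨W, hW⟩ := U.exists_isCompl
  have hWr : finrank F W = r := by
    have hsum := Submodule.finrank_add_eq_of_isCompl hW
    rw [finrank_fin_fun] at hsum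
    omega
  let b : Basis (Fin (p + r)) F (Fin (p + r) → F) :=
    (((finBasisOfFinrankEq F U hU).prod (finBasisOfFinrankEq F W hWr)).map
      (Submodule.prodEquivOfIsCompl U W hW)).reindex finSumFinEquiv
  let _ := b.invertibleToMatrix (Pi.basisFun F (Fin (p + r)))
  refine ⟨b.toMatrix (Pi.basisFun F (Fin (p + r))), isUnit_of_invertible _, fun u hu i => ?_⟩
  have mulVec_eq_repr : b.toMatrix (Pi.basisFun F (Fin (p + r))) *ᵥ u = b.repr u :=
    (Pi.basisFun F (Fin (p + r))).toMatrix_mulVec_repr b u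
  have hsymm : (Submodule.prodEquivOfIsCompl U W hW).symm u = (⟨u, hu⟩, 0) :=
    Submodule.prodEquivOfIsCompl_symm_apply_left U W hW ⟨u, hu⟩
  rw [mulVec_eq_repr]
  simp [b, hsymm]

theorem IsACI.exists_equivalent_blockUpper_of_finset (hA : IsACI A) (J : Finset (Fin n)) :
    ∃ (r s : ℕ) (hm : finrank F ↥(J.sup (colSpan A)) + r = m) (hn : J.card + s = n)
      (A₁₁ : Matrix (Fin _) (Fin _) (MvPolynomial σ F)) (A₁₂ : Matrix (Fin _) (Fin s) _)
      (A₂₂ : Matrix (Fin r) (Fin s) (MvPolynomial σ F)),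
      Equivalent A (blockUpper hm hn A₁₁ A₁₂ A₂₂) := by
  obtain ⟨p, hp⟩ : ∃ p, finrank F ↥(J.sup (colSpan A)) = p := ⟨_, rfl⟩
  obtain ⟨q, hq⟩ : ∃ q, J.card = q := ⟨_, rfl⟩
  rw [hp, hq]
  have hpm : p ≤ m := hp ▸ (Submodule.finrank_le _).trans_eq (finrank_fin_fun F)
  have hqn : q ≤ n := hq ▸ card_finset_fin_le J
  obtain ⟨r, rfl⟩ := Nat.exists_eq_add_of_le hpm
  obtain ⟨s, rfl⟩ := Nat.exists_eq_add_of_le hqn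
  obtain ⟨T, hT, hTU⟩ := exists_isUnit_mulVec_natAdd_eq_zero _ hp
  have hqc : Jᶜ.card = s := by rw [Finset.card_compl, hq, Fintype.card_fin, Nat.add_sub_cancel_left]
  let f : Equiv.Perm (Fin (q + s)) := finSumFinEquiv.symm.trans (finSumEquivOfFinset hq hqc)
  have hfJ (j) : f (Fin.castAdd s j) ∈ J := by simp [f]
  have hE := hA.equivalent_mul_submatrix hT f
  obtain ⟨A₁₁, A₁₂, A₂₂, hN⟩ := exists_eq_blockUpper
    (N := (T.map (C : F →+* MvPolynomial σ F) * A).submatrix id f) fun i j => by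
      refine eq_zero_of_degreeOf_le_one
        (fun k => (degreeOf_le_totalDegree _ k).trans (hE.2.1.degree_le_one _ _)) fun x => ?_
      have hmem : (completion A x).col (f (Fin.castAdd s j)) ∈ J.sup (colSpan A) :=
        Finset.le_sup (f := colSpan A) (hfJ j) (Submodule.subset_span ⟨x, rfl⟩)
      exact (congrFun₂ (completion_mul_submatrix A T f x) _ _).trans (hTU _ hmem i)
  exact ⟨r, s, rfl, rfl, A₁₁, A₁₂, A₂₂, hN ▸ hE⟩

theorem IsACI.exists_equivalent_blockUpper (hA : IsACI A) {ρ : ℕ} (hρ : ρ < min m n)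
    (hr : HasConstantRank A ρ) :
    ∃ (p q r s : ℕ) (hm : p + r = m) (hn : q + s = n)
      (A₁₁ : Matrix (Fin p) (Fin q) (MvPolynomial σ F))
      (A₁₂ : Matrix (Fin p) (Fin s) (MvPolynomial σ F))
      (A₂₂ : Matrix (Fin r) (Fin s) (MvPolynomial σ F)),
      Equivalent A (blockUpper hm hn A₁₁ A₁₂ A₂₂) ∧ p + s = ρ ∧ p < q ∧ s < r ∧
        HasConstantRank A₁₁ p ∧ HasConstantRank A₂₂ s := by
  obtain ⟨J, hJ⟩ := hA.exists_finrank_sup_colSpan_add_card_compl_le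
    fun x => (hasConstantRank_iff.1 hr x).le
  obtain ⟨r, s, hm, hn, A₁₁, A₁₂, A₂₂, hE⟩ := hA.exists_equivalent_blockUpper_of_finset J
  rw [Finset.card_compl, Fintype.card_fin] at hJ
  have hle : ρ ≤ finrank F ↥(J.sup (colSpan A)) + s := by
    rw [← hasConstantRank_iff.1 (hE.hasConstantRank_iff.2 hr) 0]
    exact rank_completion_blockUpper_le 0
  have hps : finrank F ↥(J.sup (colSpan A)) + s = ρ := by omega
  exact ⟨_, _, r, s, hm, hn, A₁₁, A₁₂, A₂₂, hE, hps, by omega, by omega,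
    hasConstantRank_blockUpper_iff.1 (hE.hasConstantRank_iff.2 (hps ▸ hr))⟩

end BlockUpper

end ACI

theorem mainTheorem2 {F : Type*} [Field F] {σ : Type*} {m n : ℕ}
    (A : Matrix (Fin m) (Fin n) (MvPolynomial σ F)) (hA : ACI.IsACI A)
    (ρ : ℕ) (hρ : 1 ≤ ρ) (hρ' : ρ < min m n) :
    (ACI.IsCompletelyIrreducible A ∧ ACI.HasConstantRank A ρ) ↔
      ∃ ρ₁ ρ₂ : ℕ, 0 < ρ₁ ∧ 0 < ρ₂ ∧ ρ₁ + ρ₂ = ρ ∧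
        ∃ (p q r s : ℕ) (hm : p + r = m) (hn : q + s = n)
          (A₁₁ : Matrix (Fin p) (Fin q) (MvPolynomial σ F))
          (A₁₂ : Matrix (Fin p) (Fin s) (MvPolynomial σ F))
          (A₂₂ : Matrix (Fin r) (Fin s) (MvPolynomial σ F)),
          ACI.Equivalent A (ACI.blockUpper hm hn A₁₁ A₁₂ A₂₂) ∧
          ACI.IsMinimalFullRank A₁₁ ∧ ACI.HasConstantRank A₁₁ ρ₁ ∧
          ACI.IsMaximalFullRank A₂₂ ∧ ACI.HasConstantRank A₂₂ ρ₂ := by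
  constructor
  · rintro ⟨hirr, hr⟩
    obtain ⟨p, q, r, s, hm, hn, A₁₁, A₁₂, A₂₂, hE, hps, hpq, hsr, h₁, h₂⟩ :=
      hA.exists_equivalent_blockUpper hρ' hr
    obtain ⟨hmin, hmax⟩ := (hE.isCompletelyIrreducible_iff_of_blockUpper hpq hsr h₁ h₂).1 hirr
    exact ⟨p, s, by simpa using hmin.card_pos, by simpa using hmax.card_pos, hps,
      p, q, r, s, hm, hn, A₁₁, A₁₂, A₂₂, hE, hmin, h₁, hmax, h₂⟩
  · rintro ⟨ρ₁, ρ₂, -, -, rfl, p, q, r, s, hm, hn, A₁₁, A₁₂, A₂₂, hE, hmin, hr₁, hmax, hr₂⟩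
    obtain ⟨hpq, h₁, -⟩ := ACI.isMinimalFullRank_iff.1 hmin
    obtain ⟨hsr, h₂, -⟩ := ACI.isMaximalFullRank_iff.1 hmax
    rw [Fintype.card_fin] at hpq hsr h₁ h₂
    rw [Fintype.card_fin] at hpq hsr
    obtain rfl := hr₁.unique h₁
    obtain rfl := hr₂.unique h₂
    exact ⟨(hE.isCompletelyIrreducible_iff_of_blockUpper hpq hsr h₁ h₂).2 ⟨hmin, hmax⟩,
      hE.hasConstantRank_iff.1 (ACI.hasConstantRank_blockUpper_iff.2 ⟨h₁, h₂⟩)⟩
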